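/- Let $p,n,k$ be non-negative integers. A $[p,n,k]$ complex orthogonal design (COD) is a $p\times n$ matrix $\mathcal{O}_z$ each of whose entries is $0$ or one of $z_i,\,-z_i,\,z_i^*,\,-z_i^*$ with $1\le i\le k$, where $z_1,\dots,z_k$ are complex indeterminates and $z_i^*$ is the conjugate of $z_i$, such that $$\mathcal{O}_z^{H}\mathcal{O}_z=\bigl(|z_1|^2+\cdots+|z_k|^2\bigr)I_n$$ identically in $z_1,\dots,z_k$. Its code rate is $k/p$ and its decoding delay is $p$. **Theorem.** Let $m$ be an odd positive integer. Then: 1. There is no COD with parameters $\left[\binom{2m}{m-1},\,2m,\,\binom{2m-1}{m-1}\right]$. 2. Every $[p,2m,k]$ COD of maximal rate, that is with $\dfrac{k}{p}=\dfrac{m+1}{2m}$, has decoding delay $p\ge 2\binom{2m}{m-1}$. (The numbers $n=2m$ with $m$ odd are exactly the positive integers $n\equiv 2\pmod 4$.) -/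

import Mathlib

open scoped Matrix

/-- An entry of a complex orthogonal design in the indeterminates `z_0, …, z_{k-1}`:
either `0`, or one of `z_i`, `-z_i`, `z_i^*`, `-z_i^*`. -/
inductive CODEntry (k : ℕ) : Type
  | zero : CODEntry k
  | pos (i : Fin k) : CODEntry k
  | neg (i : Fin k) : CODEntry k
  | conj (i : Fin k) : CODEntry k
  | negConj (i : Fin k) : CODEntry k

/-- The complex number that an entry stands for when the indeterminates take the values `z`. -/
noncomputable def CODEntry.eval {k : ℕ} (z : Fin k → ℂ) : CODEntry k → ℂ
  | .zero => 0
  | .pos i => z i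
  | .neg i => -z i
  | .conj i => star (z i)
  | .negConj i => -star (z i)

/-- A `[p, n, k]` complex orthogonal design: a `p × n` matrix `O` with entries
`0, ±z_i, ±z_i^*` such that `Oᴴ O = (|z_0|² + ⋯ + |z_{k-1}|²) I_n`, identically in the
indeterminates (an identity between polynomials in `z_i` and `z_i^*` over `ℂ` is the same as
an identity for all complex values of the `z_i`). -/
structure ComplexOrthogonalDesign (p n k : ℕ) : Type where
  entry : Matrix (Fin p) (Fin n) (CODEntry k)
  orthogonal : ∀ z : Fin k → ℂ,
    (entry.map (CODEntry.eval z))ᴴ * entry.map (CODEntry.eval z) =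
      (∑ i, ((‖z i‖ ^ 2 : ℝ) : ℂ)) • (1 : Matrix (Fin n) (Fin n) ℂ)

/-- The code rate `k / p`. -/
def ComplexOrthogonalDesign.rate {p n k : ℕ} (_O : ComplexOrthogonalDesign p n k) : ℚ :=
  (k : ℚ) / (p : ℚ)

/-- The decoding delay `p`. -/
def ComplexOrthogonalDesign.delay {p n k : ℕ} (_O : ComplexOrthogonalDesign p n k) : ℕ := p

/-! Call the `z_i` and `z_i^*` literals. Comparing coefficients in the orthogonality identity shows
that each column contains exactly one of `a` and `bar a`, exactly once up to sign, and that a row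
with `a` in column `l` vanishes in every other column containing `a`. For `n = 2m`, double counting
makes the maximal rate an equality case: every row has `m + 1` nonzero entries, every literal lies
in `m` columns, and a row with `a` in column `l` is nonzero in column `l` and in all columns without
`a` (`IsFull`).

In that case the signed partial permutations `transfer c d` trade column `d` for `c` in the column
set of a literal, commute when their indices are disjoint, and are negated by the anti-involution
`barTranspose`. Hence every `m`-set of columns is some `cols b`. Composing `m` of them to trade
`cols (bar a)` for `cols a` gives `X` that sends `bar a` to a literal `b` with the columns of `a`.
As `m` is odd, `barTranspose X = -X`, which kills the entry at `(a, bar a)`, so `b ≠ a`. Each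
`m`-set thus serves at least two literals, and `2k ≥ 2 * choose (2m) m` is the bound on `p`. -/

namespace CODEntry

/-! ### Literals and comparison of coefficients -/

variable {k : ℕ}

/-- The coefficient of a literal in an entry; `(i, false)` stands for `z_i` and `(i, true)` for
`z_i^*`. -/
def coeff : CODEntry k → Fin k × Bool → ℤ
  | .zero => 0
  | .pos i => Pi.single (i, false) 1
  | .neg i => Pi.single (i, false) (-1)
  | .conj i => Pi.single (i, true) 1
  | .negConj i => Pi.single (i, true) (-1)

/-- The conjugate of a literal. -/
def bar (a : Fin k × Bool) : Fin k × Bool := (a.1, !a.2)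

@[simp] theorem bar_bar (a : Fin k × Bool) : bar (bar a) = a := by simp [bar]

theorem bar_involutive : Function.Involutive (bar : Fin k × Bool → Fin k × Bool) := bar_bar

/-- The value of a literal. -/
noncomputable def literal (z : Fin k → ℂ) (a : Fin k × Bool) : ℂ :=
  if a.2 then star (z a.1) else z a.1

theorem star_literal (z : Fin k → ℂ) (a : Fin k × Bool) :
    star (literal z a) = literal z (bar a) := by
  rcases a with ⟨i, _ | _⟩ <;> simp [literal, bar]

theorem literal_add (z w : Fin k → ℂ) (a : Fin k × Bool) :
    literal (z + w) a = literal z a + literal w a := by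
  rcases a with ⟨i, _ | _⟩ <;> simp [literal]

theorem coeff_eq (e : CODEntry k) :
    e.coeff = 0 ∨ ∃ a s, (s = 1 ∨ s = -1) ∧ e.coeff = Pi.single a s := by
  cases e with
  | zero => exact Or.inl rfl
  | pos i => exact Or.inr ⟨(i, false), 1, by simp, rfl⟩
  | neg i => exact Or.inr ⟨(i, false), -1, by simp, rfl⟩
  | conj i => exact Or.inr ⟨(i, true), 1, by simp, rfl⟩
  | negConj i => exact Or.inr ⟨(i, true), -1, by simp, rfl⟩

theorem coeff_inj (e : CODEntry k) {a b : Fin k × Bool} (ha : e.coeff a ≠ 0)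
    (hb : e.coeff b ≠ 0) : a = b := by
  rcases e.coeff_eq with h | ⟨c, s, -, h⟩
  · simp [h] at ha
  · rw [h, Pi.single_apply] at ha hb
    have h1 : a = c := by by_contra hne; simp [hne] at ha
    have h2 : b = c := by by_contra hne; simp [hne] at hb
    rw [h1, h2]

theorem coeff_mul_self (e : CODEntry k) {a : Fin k × Bool} (ha : e.coeff a ≠ 0) :
    e.coeff a * e.coeff a = 1 := by
  rcases e.coeff_eq with h | ⟨c, s, hs, h⟩
  · simp [h] at ha
  · have h1 : a = c := by
      by_contra hne
      simp [h, hne] at ha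
    subst h1
    rcases hs with rfl | rfl <;> simp [h]

theorem eval_eq_sum (z : Fin k → ℂ) (e : CODEntry k) :
    e.eval z = ∑ a, (e.coeff a : ℂ) * literal z a := by
  cases e <;> simp only [eval, coeff, Pi.single_apply, Pi.zero_apply, Int.cast_ite, ite_mul,
    Int.cast_zero, zero_mul, Finset.sum_const_zero, Finset.sum_ite_eq', Finset.mem_univ, if_true] <;>
    simp [literal]

theorem star_eval_eq_sum (z : Fin k → ℂ) (e : CODEntry k) :
    star (e.eval z) = ∑ a, (e.coeff a : ℂ) * literal z (bar a) := by
  rw [eval_eq_sum, star_sum]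
  refine Finset.sum_congr rfl fun a _ => ?_
  rw [star_mul', star_literal]
  simp

/-- A quadratic form in the literals that vanishes identically has vanishing symmetrization. -/
theorem add_swap_eq_zero_of_forall_sum_eq_zero (N : Fin k × Bool → Fin k × Bool → ℂ)
    (h : ∀ z : Fin k → ℂ, ∑ a, ∑ b, N a b * (literal z a * literal z b) = 0)
    (a b : Fin k × Bool) : N a b + N b a = 0 := by
  have hpol : ∀ z w : Fin k → ℂ,
      ∑ a, ∑ b, (N a b + N b a) * (literal z a * literal w b) = 0 := by
    intro z w
    have h1 := h (z + w)
    have h2 := h z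
    have h3 := h w
    have h4 : ∑ a, ∑ b, N b a * (literal z a * literal w b)
        = ∑ a, ∑ b, N a b * (literal w a * literal z b) := by
      rw [Finset.sum_comm]
      refine Finset.sum_congr rfl fun a _ => Finset.sum_congr rfl fun b _ => by ring
    have h5 : ∑ a, ∑ b, N a b * (literal (z + w) a * literal (z + w) b)
        = ∑ a, ∑ b, N a b * (literal z a * literal z b)
          + ∑ a, ∑ b, N a b * (literal w a * literal w b)
          + ∑ a, ∑ b, N a b * (literal z a * literal w b)
          + ∑ a, ∑ b, N a b * (literal w a * literal z b) := by
      simp only [← Finset.sum_add_distrib, literal_add]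
      refine Finset.sum_congr rfl fun a _ => Finset.sum_congr rfl fun b _ => by ring
    have h6 : ∑ a, ∑ b, (N a b + N b a) * (literal z a * literal w b)
        = ∑ a, ∑ b, N a b * (literal z a * literal w b)
          + ∑ a, ∑ b, N b a * (literal z a * literal w b) := by
      simp only [← Finset.sum_add_distrib]
      refine Finset.sum_congr rfl fun a _ => Finset.sum_congr rfl fun b _ => by ring
    rw [h6, h4]
    linear_combination h1 - h2 - h3 - h5
  obtain ⟨i, x⟩ := a
  obtain ⟨j, y⟩ := b
  set S : Bool → Bool → ℂ := fun x y => N (i, x) (j, y) + N (j, y) (i, x) with hS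
  have key : ∀ c d : ℂ, S false false * (c * d) + S false true * (c * star d)
      + S true false * (star c * d) + S true true * (star c * star d) = 0 := by
    intro c d
    have := hpol (Pi.single i c) (Pi.single j d)
    have hl : ∀ (i a : Fin k) (x : Bool) (c : ℂ), literal (Pi.single i c) (a, x) =
        if a = i then (if x then star c else c) else 0 := by
      intro i a x c
      by_cases ha : a = i
      · subst ha; simp [literal]
      · cases x <;> simp [literal, ha]
    simp only [Fintype.sum_prod_type, Fintype.sum_bool, hl, ite_mul, mul_ite, zero_mul, mul_zero,
      Finset.sum_add_distrib, Finset.sum_ite_eq', Finset.mem_univ, if_true, Bool.false_eq_true,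
      if_false] at this
    simp only [hS]
    linear_combination this
  -- Values in `{1, I}` suffice to separate the four monomials: the resulting linear system is
  -- invertible.
  have k1 := key 1 1
  have k2 := key 1 Complex.I
  have k3 := key Complex.I 1
  have k4 := key Complex.I Complex.I
  simp only [star_one, Complex.star_def, Complex.conj_I] at k2 k3 k4
  simp only [star_one] at k1
  have hI := Complex.I_mul_I
  change S x y = 0
  cases x <;> cases y
  · linear_combination (1 / 4) * (k1 - Complex.I * k2 - Complex.I * k3 - k4 + hI *
      (3 * S false false - S false true - S true false - S true true))
  · linear_combination (1 / 4) * (k1 + Complex.I * k2 - Complex.I * k3 + k4 + hI *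
      (3 * S false true - S false false - S true false - S true true))
  · linear_combination (1 / 4) * (k1 - Complex.I * k2 + Complex.I * k3 + k4 + hI *
      (3 * S true false - S false false - S false true - S true true))
  · linear_combination (1 / 4) * (k1 + Complex.I * k2 + Complex.I * k3 - k4 + hI *
      (3 * S true true - S false false - S false true - S true false))

end CODEntry

/-! ### Column sets of literals, supports of rows, double counting -/

namespace ComplexOrthogonalDesign

open CODEntry

variable {p n k : ℕ} (O : ComplexOrthogonalDesign p n k)

/-- The matrix of the coefficients of the literals in column `j`. -/
def coef (j : Fin n) : Matrix (Fin p) (Fin k × Bool) ℤ :=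
  Matrix.of fun r a => (O.entry r j).coeff a

/-- The columns that contain a literal, up to sign. -/
def cols (a : Fin k × Bool) : Finset (Fin n) :=
  Finset.univ.filter fun j => ∃ r, O.coef j r a ≠ 0

/-- The columns in which a row is nonzero. -/
def supp (r : Fin p) : Finset (Fin n) :=
  Finset.univ.filter fun j => ∃ a, O.coef j r a ≠ 0

variable {O}

theorem mem_cols {a : Fin k × Bool} {j : Fin n} : j ∈ O.cols a ↔ ∃ r, O.coef j r a ≠ 0 := by
  simp [cols]

theorem mem_supp {r : Fin p} {j : Fin n} : j ∈ O.supp r ↔ ∃ a, O.coef j r a ≠ 0 := by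
  simp [supp]

theorem literal_unique {j : Fin n} {r : Fin p} {a b : Fin k × Bool} (ha : O.coef j r a ≠ 0)
    (hb : O.coef j r b ≠ 0) : a = b :=
  coeff_inj _ ha hb

theorem coef_mul_self {j : Fin n} {r : Fin p} {a : Fin k × Bool} (ha : O.coef j r a ≠ 0) :
    O.coef j r a * O.coef j r a = 1 :=
  coeff_mul_self _ ha

variable (O)

theorem sum_coef_add (j l : Fin n) (a b : Fin k × Bool) :
    ∑ r, O.coef j r a * O.coef l r b + ∑ r, O.coef j r (bar b) * O.coef l r (bar a) =
      if j = l ∧ a = b then 1 else 0 := by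
  -- Conjugating column `j` turns `a` into `bar a`. Each `|z_i|^2` arises from both orders of `z_i`
  -- and `z_i^*`, hence the `1 / 2`.
  set N : Fin k × Bool → Fin k × Bool → ℂ := fun a b =>
    ∑ r, (O.coef j r (bar a) : ℂ) * O.coef l r b - if j = l ∧ bar a = b then 1 / 2 else 0 with hN
  have hzero : ∀ z : Fin k → ℂ, ∑ a, ∑ b, N a b * (literal z a * literal z b) = 0 := by
    intro z
    have h := congrFun (congrFun (O.orthogonal z) j) l
    simp only [Matrix.mul_apply, Matrix.conjTranspose_apply, Matrix.map_apply, Matrix.smul_apply,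
      star_eval_eq_sum, smul_eq_mul] at h
    have h1 : ∀ r, (∑ a, ((O.entry r j).coeff a : ℂ) * literal z (bar a)) =
        ∑ a, (O.coef j r (bar a) : ℂ) * literal z a := by
      intro r
      rw [← Equiv.sum_comp (bar_involutive (k := k)).toPerm]
      refine Finset.sum_congr rfl fun a _ => ?_
      simp [coef]
    have h2 : ∀ r, (O.entry r l).eval z = ∑ b, (O.coef l r b : ℂ) * literal z b :=
      fun r => eval_eq_sum z _
    have h3 : ∑ a, ∑ b, (if j = l ∧ bar a = b then (1 / 2 : ℂ) else 0) *
        (literal z a * literal z b) =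
        (∑ i, ((‖z i‖ ^ 2 : ℝ) : ℂ)) * (1 : Matrix (Fin n) (Fin n) ℂ) j l := by
      by_cases hjl : j = l
      · subst hjl
        simp only [true_and, ite_mul, zero_mul, Finset.sum_ite_eq, Finset.mem_univ, if_true,
          Matrix.one_apply_eq, mul_one, Fintype.sum_prod_type, Fintype.sum_bool]
        refine Finset.sum_congr rfl fun i _ => ?_
        have := Complex.conj_mul' (z i)
        simp only [literal, bar, Complex.star_def, Bool.not_true, Bool.not_false, if_true,
          Bool.false_eq_true, if_false]
        push_cast
        linear_combination this
      · simp [hjl]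
    have h4 : ∑ a, ∑ b, (∑ r, (O.coef j r (bar a) : ℂ) * O.coef l r b) *
        (literal z a * literal z b) = (∑ i, ((‖z i‖ ^ 2 : ℝ) : ℂ)) *
          (1 : Matrix (Fin n) (Fin n) ℂ) j l := by
      rw [← h]
      simp only [h1, h2, Finset.sum_mul_sum]
      conv_rhs => rw [Finset.sum_comm]; enter [2, a]; rw [Finset.sum_comm]
      refine Finset.sum_congr rfl fun a _ => Finset.sum_congr rfl fun b _ => ?_
      rw [Finset.sum_mul]
      exact Finset.sum_congr rfl fun r _ => by ring
    simp only [hN, sub_mul, Finset.sum_sub_distrib]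
    rw [h3, h4, sub_self]
  have h := add_swap_eq_zero_of_forall_sum_eq_zero N hzero (bar a) b
  have hc : (a = b) ↔ (bar b = bar a) := by
    rw [(bar_involutive (k := k)).injective.eq_iff]; exact eq_comm
  simp only [hN, bar_bar, ← hc] at h
  have h' : ((∑ r, O.coef j r a * O.coef l r b +
      ∑ r, O.coef j r (bar b) * O.coef l r (bar a) : ℤ) : ℂ) =
      ((if j = l ∧ a = b then 1 else 0 : ℤ) : ℂ) := by
    push_cast
    split_ifs at h ⊢ <;> linear_combination h
  exact_mod_cast h'

theorem sum_coef_mul_self_add (j : Fin n) (a : Fin k × Bool) :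
    ∑ r, O.coef j r a * O.coef j r a + ∑ r, O.coef j r (bar a) * O.coef j r (bar a) = 1 := by
  simpa using O.sum_coef_add j j a a

variable {O}

theorem row_unique {j : Fin n} {r s : Fin p} {a : Fin k × Bool} (hr : O.coef j r a ≠ 0)
    (hs : O.coef j s a ≠ 0) : r = s := by
  by_contra hrs
  have h := O.sum_coef_mul_self_add j a
  have h1 : (0 : ℤ) ≤ ∑ r, O.coef j r (bar a) * O.coef j r (bar a) :=
    Finset.sum_nonneg fun _ _ => mul_self_nonneg _
  have h2 : ∑ t ∈ {r, s}, O.coef j t a * O.coef j t a ≤ ∑ t, O.coef j t a * O.coef j t a :=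
    Finset.sum_le_sum_of_subset_of_nonneg (Finset.subset_univ _) fun _ _ _ => mul_self_nonneg _
  rw [Finset.sum_pair hrs, coef_mul_self hr, coef_mul_self hs] at h2
  omega

theorem sum_coef_mul_self_of_mem {j : Fin n} {a : Fin k × Bool} (h : j ∈ O.cols a) :
    ∑ r, O.coef j r a * O.coef j r a = 1 := by
  obtain ⟨r, hr⟩ := mem_cols.1 h
  rw [Finset.sum_eq_single r, coef_mul_self hr]
  · intro s _ hs
    by_contra h0
    exact hs (row_unique (left_ne_zero_of_mul h0) hr)
  · simp

theorem sum_coef_mul_self_of_notMem {j : Fin n} {a : Fin k × Bool} (h : j ∉ O.cols a) :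
    ∑ r, O.coef j r a * O.coef j r a = 0 := by
  refine Finset.sum_eq_zero fun r _ => ?_
  by_contra h0
  exact h (mem_cols.2 ⟨r, left_ne_zero_of_mul h0⟩)

theorem mem_cols_bar {j : Fin n} {a : Fin k × Bool} : j ∈ O.cols (bar a) ↔ j ∉ O.cols a := by
  have h := O.sum_coef_mul_self_add j a
  by_cases h1 : j ∈ O.cols a <;> by_cases h2 : j ∈ O.cols (bar a)
  · rw [sum_coef_mul_self_of_mem h1, sum_coef_mul_self_of_mem h2] at h; omega
  · simp [h1, h2]
  · simp [h1, h2]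
  · rw [sum_coef_mul_self_of_notMem h1, sum_coef_mul_self_of_notMem h2] at h; omega

theorem cols_bar (a : Fin k × Bool) : O.cols (bar a) = (O.cols a)ᶜ := by
  ext j; simp [mem_cols_bar]

/-- A nonzero product of the entries in columns `j` and `l` of row `r` could only be cancelled by a
row with `bar a` in column `j`, but that column already contains `a`. -/
theorem notMem_supp {j l : Fin n} {r : Fin p} {a : Fin k × Bool} (ha : O.coef l r a ≠ 0)
    (hjl : j ≠ l) (hj : j ∈ O.cols a) : j ∉ O.supp r := by
  intro hjr
  obtain ⟨b, hb⟩ := mem_supp.1 hjr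
  have h := O.sum_coef_add j l b a
  rw [if_neg (by simp [hjl]), Finset.sum_eq_single r] at h
  · rw [Finset.sum_eq_zero, add_zero] at h
    · exact mul_ne_zero hb ha h
    · intro s _
      by_contra h0
      exact mem_cols_bar.1 (mem_cols.2 ⟨s, left_ne_zero_of_mul h0⟩) hj
  · intro s _ hs
    by_contra h0
    exact hs (row_unique (right_ne_zero_of_mul h0) ha)
  · simp

theorem supp_subset {l : Fin n} {r : Fin p} {a : Fin k × Bool} (ha : O.coef l r a ≠ 0) :
    O.supp r ⊆ insert l (O.cols a)ᶜ := by
  intro j hj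
  by_contra h
  rw [Finset.mem_insert, Finset.mem_compl, not_or, not_not] at h
  exact notMem_supp ha h.1 h.2 hj

theorem card_cols_eq_sum (a : Fin k × Bool) :
    ((O.cols a).card : ℤ) = ∑ j, ∑ r, O.coef j r a * O.coef j r a := by
  rw [cols, Finset.card_filter]
  push_cast
  refine Finset.sum_congr rfl fun j _ => ?_
  split_ifs with h
  · rw [sum_coef_mul_self_of_mem (mem_cols.2 h)]
  · rw [sum_coef_mul_self_of_notMem (mt mem_cols.1 h)]

theorem card_supp_eq_sum (r : Fin p) :
    ((O.supp r).card : ℤ) = ∑ j, ∑ a, O.coef j r a * O.coef j r a := by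
  rw [supp, Finset.card_filter]
  push_cast
  refine Finset.sum_congr rfl fun j _ => ?_
  split_ifs with h
  · obtain ⟨a, ha⟩ := h
    rw [Finset.sum_eq_single a, coef_mul_self ha]
    · intro b _ hb
      by_contra h0
      exact hb (literal_unique (left_ne_zero_of_mul h0) ha)
    · simp
  · rw [Finset.sum_eq_zero]
    intro a _
    by_contra h0
    exact h ⟨a, left_ne_zero_of_mul h0⟩

theorem sum_card_cols : ∑ a, ((O.cols a).card : ℤ) = n * k := by
  have h : ∀ i : Fin k, ((O.cols (i, true)).card : ℤ) + ((O.cols (i, false)).card : ℤ) = n := by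
    intro i
    have := O.cols_bar (i, true)
    rw [show bar (i, true) = (i, false) from rfl] at this
    have h2 := Finset.card_add_card_compl (O.cols (i, true))
    rw [← this, Fintype.card_fin] at h2
    exact_mod_cast h2
  simp [Fintype.sum_prod_type, h, mul_comm]

theorem sum_card_supp : ∑ r, ((O.supp r).card : ℤ) = n * k := by
  rw [← O.sum_card_cols]
  simp only [card_cols_eq_sum, card_supp_eq_sum]
  rw [Finset.sum_comm]
  conv_rhs => rw [Finset.sum_comm]
  exact Finset.sum_congr rfl fun j _ => Finset.sum_comm

/-- Sum `|supp r|` over all nonzero entries, bounding it by `n + 1 - |cols a|` at an entry with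
literal `a`. -/
theorem sum_card_supp_sq_le :
    ∑ r, ((O.supp r).card : ℤ) ^ 2 ≤ ∑ a, ((O.cols a).card : ℤ) * (n + 1 - (O.cols a).card) := by
  have h : ∑ r, ((O.supp r).card : ℤ) ^ 2 =
      ∑ a, ∑ j, ∑ r, O.coef j r a * O.coef j r a * ((O.supp r).card : ℤ) := by
    have : ∀ r, ((O.supp r).card : ℤ) ^ 2 =
        ∑ j, ∑ a, O.coef j r a * O.coef j r a * ((O.supp r).card : ℤ) := by
      intro r
      simp only [← Finset.sum_mul]
      rw [← card_supp_eq_sum, sq]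
    simp only [this]
    rw [Finset.sum_comm]
    conv_rhs => rw [Finset.sum_comm]
    exact Finset.sum_congr rfl fun j _ => Finset.sum_comm
  rw [h]
  refine Finset.sum_le_sum fun a _ => ?_
  rw [card_cols_eq_sum, Finset.sum_mul, ← card_cols_eq_sum]
  refine Finset.sum_le_sum fun j _ => ?_
  rw [Finset.sum_mul]
  refine Finset.sum_le_sum fun r _ => ?_
  by_cases h0 : O.coef j r a = 0
  · simp [h0]
  · refine mul_le_mul_of_nonneg_left ?_ (mul_self_nonneg _)
    have h1 := (Finset.card_le_card (supp_subset h0)).trans (Finset.card_insert_le _ _)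
    have h2 := Finset.card_add_card_compl (O.cols a)
    rw [Fintype.card_fin] at h2
    omega

end ComplexOrthogonalDesign

/-! ### The equality case: maximal rate with `2m` columns -/

namespace ComplexOrthogonalDesign

open CODEntry

variable {p m k : ℕ} {O : ComplexOrthogonalDesign p (2 * m) k}

/-- Since `c(2m + 1 - c) = c + m^2 - (c - m)^2`, the second-moment bound forces the sum of `(|supp
r| - (m + 1))^2` to be at most zero. -/
theorem card_supp_of_maximal_rate (h : (m + 1) * p = 2 * m * k) (r : Fin p) :
    (O.supp r).card = m + 1 := by
  have h1 := O.sum_card_supp_sq_le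
  have h2 := O.sum_card_supp
  have h3 := O.sum_card_cols
  have h' : ((m : ℤ) + 1) * p = 2 * m * k := by exact_mod_cast h
  push_cast at h1 h2 h3
  have h4 : ∑ a, ((O.cols a).card : ℤ) * (2 * m + 1 - (O.cols a).card) ≤
      ∑ a, (((O.cols a).card : ℤ) + m ^ 2) :=
    Finset.sum_le_sum fun a _ => by nlinarith [sq_nonneg (((O.cols a).card : ℤ) - m)]
  rw [Finset.sum_add_distrib, h3, Finset.sum_const, Finset.card_univ, Fintype.card_prod,
    Fintype.card_fin, Fintype.card_bool, nsmul_eq_mul] at h4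
  have h5 : ∑ r, (((O.supp r).card : ℤ) - (m + 1)) ^ 2 =
      ∑ r, ((O.supp r).card : ℤ) ^ 2 - 2 * (m + 1) * ∑ r, ((O.supp r).card : ℤ)
        + (m + 1) ^ 2 * p := by
    rw [Finset.mul_sum, ← Finset.sum_sub_distrib,
      show ((m : ℤ) + 1) ^ 2 * p = ∑ _r : Fin p, ((m : ℤ) + 1) ^ 2 by simp [mul_comm],
      ← Finset.sum_add_distrib]
    exact Finset.sum_congr rfl fun r _ => by ring
  have h6 : ∑ r, (((O.supp r).card : ℤ) - (m + 1)) ^ 2 ≤ 0 := by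
    rw [h5, h2]
    push_cast at h4
    have : ((m : ℤ) + 1) ^ 2 * p = (m + 1) * (2 * m * k) := by rw [← h']; ring
    rw [this]
    linarith
  have h7 := (Finset.sum_eq_zero_iff_of_nonneg (fun r _ => sq_nonneg _)).1
    (le_antisymm h6 (Finset.sum_nonneg fun r _ => sq_nonneg (((O.supp r).card : ℤ) - (m + 1))))
    r (Finset.mem_univ r)
  have h8 := pow_eq_zero_iff (two_ne_zero) |>.1 h7
  omega

theorem card_cols_le_of_maximal_rate (h : (m + 1) * p = 2 * m * k) (a : Fin k × Bool) :
    (O.cols a).card ≤ m := by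
  rcases (O.cols a).eq_empty_or_nonempty with h0 | ⟨l, hl⟩
  · simp [h0]
  · obtain ⟨r, hr⟩ := mem_cols.1 hl
    have h1 := (Finset.card_le_card (supp_subset hr)).trans (Finset.card_insert_le _ _)
    rw [card_supp_of_maximal_rate h] at h1
    have h2 := Finset.card_add_card_compl (O.cols a)
    rw [Fintype.card_fin] at h2
    omega

theorem card_cols_of_maximal_rate (h : (m + 1) * p = 2 * m * k) (a : Fin k × Bool) :
    (O.cols a).card = m := by
  have h1 := card_cols_le_of_maximal_rate (O := O) h a
  have h2 := card_cols_le_of_maximal_rate (O := O) h (bar a)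
  have h3 := Finset.card_add_card_compl (O.cols a)
  rw [← cols_bar, Fintype.card_fin] at h3
  omega

theorem supp_eq_of_maximal_rate (h : (m + 1) * p = 2 * m * k) {l : Fin (2 * m)} {r : Fin p}
    {a : Fin k × Bool} (ha : O.coef l r a ≠ 0) : O.supp r = insert l (O.cols a)ᶜ := by
  refine Finset.eq_of_subset_of_card_le (supp_subset ha) ?_
  refine (Finset.card_insert_le _ _).trans ?_
  have h3 := Finset.card_add_card_compl (O.cols a)
  rw [card_cols_of_maximal_rate h, Fintype.card_fin] at h3
  rw [card_supp_of_maximal_rate h]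
  omega

end ComplexOrthogonalDesign

/-! ### Transfer matrices and their anti-involution -/

namespace ComplexOrthogonalDesign

open CODEntry

/-- Transposition of matrices indexed by literals, combined with conjugation of the literals. -/
def barTranspose {k : ℕ} (M : Matrix (Fin k × Bool) (Fin k × Bool) ℤ) :
    Matrix (Fin k × Bool) (Fin k × Bool) ℤ :=
  Mᵀ.submatrix bar bar

theorem barTranspose_mul {k : ℕ} (M N : Matrix (Fin k × Bool) (Fin k × Bool) ℤ) :
    barTranspose (M * N) = barTranspose N * barTranspose M := by
  have := Matrix.submatrix_mul_equiv Nᵀ Mᵀ (bar (k := k)) (bar_involutive (k := k)).toPerm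
    (bar (k := k))
  rw [barTranspose, Matrix.transpose_mul, ← this]
  rfl

theorem barTranspose_sub {k : ℕ} (M N : Matrix (Fin k × Bool) (Fin k × Bool) ℤ) :
    barTranspose (M - N) = barTranspose M - barTranspose N := rfl

theorem barTranspose_one {k : ℕ} :
    barTranspose (1 : Matrix (Fin k × Bool) (Fin k × Bool) ℤ) = 1 := by
  rw [barTranspose, Matrix.transpose_one]
  exact Matrix.submatrix_one _ bar_involutive.injective

variable {p n k : ℕ} (O : ComplexOrthogonalDesign p n k)

/-- The matrix that takes a literal in column `l` to the literal in the same row and column `j`. -/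
def transfer (j l : Fin n) : Matrix (Fin k × Bool) (Fin k × Bool) ℤ := (O.coef j)ᵀ * O.coef l

/-- A row that contains the literal `a` is nonzero in exactly those other columns that do not
contain `a`. -/
def IsFull : Prop :=
  ∀ (l : Fin n) (r : Fin p) (a : Fin k × Bool), O.coef l r a ≠ 0 →
    O.supp r = insert l (O.cols a)ᶜ

variable {O}

theorem barTranspose_transfer {j l : Fin n} (h : j ≠ l) :
    barTranspose (O.transfer j l) = -O.transfer j l := by
  ext a b
  have := O.sum_coef_add j l a b
  simp only [h, false_and, if_false] at this
  simp only [barTranspose, transfer, Matrix.submatrix_apply, Matrix.transpose_apply,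
    Matrix.mul_apply, Matrix.neg_apply]
  linarith

theorem barTranspose_transfer_self (l : Fin n) :
    barTranspose (O.transfer l l) = 1 - O.transfer l l := by
  ext a b
  have := O.sum_coef_add l l a b
  simp only [true_and] at this
  simp only [barTranspose, transfer, Matrix.submatrix_apply, Matrix.transpose_apply,
    Matrix.mul_apply, Matrix.sub_apply, Matrix.one_apply]
  linarith

theorem transpose_coef_mul_coef (l : Fin n) :
    (O.coef l)ᵀ * O.coef l = Matrix.diagonal fun a => if l ∈ O.cols a then 1 else 0 := by
  ext a b
  rw [Matrix.mul_apply, Matrix.diagonal_apply]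
  simp only [Matrix.transpose_apply]
  split_ifs with hab hl
  · subst hab; exact sum_coef_mul_self_of_mem hl
  · subst hab; exact sum_coef_mul_self_of_notMem hl
  · refine Finset.sum_eq_zero fun r _ => ?_
    by_contra h0
    exact hab (literal_unique (left_ne_zero_of_mul h0) (right_ne_zero_of_mul h0))

theorem coef_mul_transpose_coef (l : Fin n) :
    O.coef l * (O.coef l)ᵀ = Matrix.diagonal fun r => if l ∈ O.supp r then 1 else 0 := by
  ext r s
  rw [Matrix.mul_apply, Matrix.diagonal_apply]
  simp only [Matrix.transpose_apply]
  split_ifs with hrs hl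
  · subst hrs
    obtain ⟨a, ha⟩ := mem_supp.1 hl
    rw [Finset.sum_eq_single a, coef_mul_self ha]
    · intro b _ hb
      by_contra h0
      exact hb (literal_unique (left_ne_zero_of_mul h0) ha)
    · simp
  · subst hrs
    refine Finset.sum_eq_zero fun a _ => ?_
    by_contra h0
    exact hl (mem_supp.2 ⟨a, left_ne_zero_of_mul h0⟩)
  · refine Finset.sum_eq_zero fun a _ => ?_
    by_contra h0
    exact hrs (row_unique (left_ne_zero_of_mul h0) (right_ne_zero_of_mul h0))

theorem coef_mul_transpose_mul_coef {j l : Fin n} (h : l ≠ j) :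
    O.coef l * (O.coef j)ᵀ * O.coef l = 0 := by
  ext r a
  rw [Matrix.mul_apply]
  refine Finset.sum_eq_zero fun s _ => ?_
  by_contra h0
  have h1 := left_ne_zero_of_mul h0
  rw [Matrix.mul_apply] at h1
  obtain ⟨b, -, hb⟩ := Finset.exists_ne_zero_of_sum_ne_zero h1
  exact notMem_supp (right_ne_zero_of_mul hb) h (mem_cols.2 ⟨r, left_ne_zero_of_mul hb⟩)
    (mem_supp.2 ⟨a, right_ne_zero_of_mul h0⟩)

theorem transfer_mul_transfer_eq_zero {i j l : Fin n} (h : l ≠ j) :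
    O.transfer i l * O.transfer j l = 0 := by
  have := coef_mul_transpose_mul_coef (O := O) h
  simp only [transfer, Matrix.mul_assoc] at this ⊢
  rw [this, Matrix.mul_zero]

theorem transfer_mul_transfer_eq_zero' {i j l : Fin n} (h : i ≠ l) :
    O.transfer i l * O.transfer i j = 0 := by
  have := congrArg Matrix.transpose (coef_mul_transpose_mul_coef (O := O) h)
  simp only [Matrix.transpose_mul, Matrix.transpose_transpose, Matrix.transpose_zero] at this
  simp only [transfer, ← Matrix.mul_assoc] at this ⊢
  rw [this, Matrix.zero_mul]

namespace IsFull

variable (hO : O.IsFull)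
include hO

/-- Both products with `O.coef l` are diagonal projections; by fullness, exactly one of them fixes
any given nonzero entry of `O.coef j`. -/
theorem coef_anticomm {j l : Fin n} (h : l ≠ j) :
    O.coef l * (O.coef l)ᵀ * O.coef j + O.coef j * ((O.coef l)ᵀ * O.coef l) = O.coef j := by
  rw [transpose_coef_mul_coef, coef_mul_transpose_coef]
  ext r a
  rw [Matrix.add_apply, Matrix.diagonal_mul, Matrix.mul_diagonal]
  by_cases h0 : O.coef j r a = 0
  · simp [h0]
  · rw [hO _ _ _ h0]
    by_cases hl : l ∈ O.cols a <;> simp [hl, h]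

theorem transfer_mul_transfer {i j l : Fin n} (h : l ≠ j) :
    O.transfer i l * O.transfer l j = O.transfer i j - O.transfer i j * O.transfer l l := by
  have := congrArg ((O.coef i)ᵀ * ·) (hO.coef_anticomm h)
  simp only [transfer, Matrix.mul_add, Matrix.mul_assoc] at this ⊢
  exact eq_sub_of_add_eq this

theorem transfer_self_mul_transfer {i j l : Fin n} (hi : l ≠ i) (hj : l ≠ j) :
    O.transfer l l * O.transfer i j = O.transfer i j * O.transfer l l := by
  have h1 := congrArg ((O.coef i)ᵀ * ·) (hO.coef_anticomm hj)
  have h2 := congrArg (fun M => Mᵀ * O.coef j) (hO.coef_anticomm hi)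
  simp only [transfer, Matrix.transpose_add, Matrix.transpose_mul, Matrix.transpose_transpose,
    Matrix.mul_add, Matrix.add_mul, Matrix.mul_assoc] at h1 h2 ⊢
  rw [← h2] at h1
  rw [add_comm] at h1
  exact (add_left_cancel ((add_comm _ _).trans h1)).symm

/-- The matrix-unit relation of `gl_n`: subtract from `transfer_mul_transfer` its image under
`barTranspose`. -/
theorem transfer_commutator {i j l : Fin n} (hil : i ≠ l) (hlj : l ≠ j) (hij : i ≠ j) :
    O.transfer i l * O.transfer l j - O.transfer l j * O.transfer i l = O.transfer i j := by
  have h1 := hO.transfer_mul_transfer (i := i) hlj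
  have h2 := congrArg barTranspose h1
  rw [barTranspose_sub, barTranspose_mul, barTranspose_mul, barTranspose_transfer hil,
    barTranspose_transfer hlj, barTranspose_transfer hij, barTranspose_transfer_self,
    neg_mul_neg] at h2
  rw [h1, h2, mul_neg, sub_mul, one_mul, hO.transfer_self_mul_transfer hil.symm hlj]
  abel

/-- Expanding one factor as a commutator shows that both products equal `-(O.transfer j i' *
O.transfer i j')`. -/
theorem transfer_commute {i i' j j' : Fin n} (h1 : i ≠ i') (h2 : j ≠ j') (h3 : i ≠ j)
    (h4 : i' ≠ j') (h5 : i ≠ j') (h6 : i' ≠ j) :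
    Commute (O.transfer i i') (O.transfer j j') := by
  have e1 := hO.transfer_commutator h6.symm h4 h2
  have e2 := hO.transfer_commutator h1 h4 h5
  have e3 : O.transfer i i' * O.transfer j i' = 0 := transfer_mul_transfer_eq_zero h6
  have e4 : O.transfer j i' * O.transfer i i' = 0 := transfer_mul_transfer_eq_zero h1.symm
  have e5 := hO.transfer_commutator h3.symm h5 h2
  have e6 := hO.transfer_commutator h3.symm h1 h6.symm
  have e7 : O.transfer i i' * O.transfer i j' = 0 := transfer_mul_transfer_eq_zero' h1
  have left : O.transfer i i' * O.transfer j j' = -(O.transfer j i' * O.transfer i j') := by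
    rw [← e5, mul_sub, ← mul_assoc, ← mul_assoc, e7, zero_mul, sub_zero,
      show O.transfer i i' * O.transfer j i = O.transfer j i * O.transfer i i' - O.transfer j i' by
        rw [← e6]; abel, sub_mul, mul_assoc, e7, mul_zero, zero_sub]
  have right : O.transfer j j' * O.transfer i i' = -(O.transfer j i' * O.transfer i j') := by
    rw [← e1, sub_mul, mul_assoc, mul_assoc, e4, mul_zero, sub_zero,
      show O.transfer i' j' * O.transfer i i' = O.transfer i i' * O.transfer i' j' -
        O.transfer i j' by rw [← e2]; abel, mul_sub, ← mul_assoc, e4, zero_mul, zero_sub]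
  exact left.trans right.symm

theorem exists_transfer_apply_ne_zero_iff {c d : Fin n} {a : Fin k × Bool} (hd : d ∈ O.cols a)
    (hc : c ∉ O.cols a) : ∃ b, O.cols b = insert c ((O.cols a).erase d) ∧
      ∀ x, O.transfer c d x a ≠ 0 ↔ x = b := by
  obtain ⟨r, hr⟩ := mem_cols.1 hd
  have hs := hO _ _ _ hr
  have hcs : c ∈ O.supp r := by simp [hs, hc]
  obtain ⟨b, hb⟩ := mem_supp.1 hcs
  have hs' := hO _ _ _ hb
  have hcb : c ∈ O.cols b := mem_cols.2 ⟨r, hb⟩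
  have hval : ∀ x, O.transfer c d x a = O.coef c r x * O.coef d r a := by
    intro x
    rw [transfer, Matrix.mul_apply, Finset.sum_eq_single r]
    · rfl
    · intro s _ hs
      by_contra h0
      exact hs (row_unique (right_ne_zero_of_mul h0) hr)
    · simp
  refine ⟨b, ?_, fun x => ?_⟩
  · ext x
    have hx := congrArg (x ∈ ·) (hs.symm.trans hs')
    simp only [Finset.mem_insert, Finset.mem_compl, eq_iff_iff, Finset.mem_erase] at hx ⊢
    by_cases hxc : x = c
    · subst hxc; simp [hcb]
    · by_cases hxd : x = d
      · subst hxd; simp_all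
      · simp only [hxc, hxd, false_or, not_false_eq_true, ne_eq, true_and] at hx ⊢
        exact (not_iff_not.1 hx).symm
  · rw [hval]
    constructor
    · exact fun h => literal_unique (left_ne_zero_of_mul h) hb
    · rintro rfl
      exact mul_ne_zero hb hr

/-- `X` is a product of transfers along a pairing of `s` with `t`. The commutation clause
strengthens the induction: `barTranspose` reverses products, and commuting restores the order,
leaving one sign per factor. -/
theorem exists_exchange (s : Finset (Fin n)) : ∀ t : Finset (Fin n), s.card = t.card →
    Disjoint s t → ∃ X : Matrix (Fin k × Bool) (Fin k × Bool) ℤ,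
      barTranspose X = (-1 : ℤ) ^ s.card • X ∧
      (∀ c d, c ∉ s → c ∉ t → d ∉ s → d ∉ t → c ≠ d → Commute (O.transfer c d) X) ∧
      ∀ a, s ⊆ O.cols a → Disjoint t (O.cols a) →
        ∃ b, O.cols b = (O.cols a \ s) ∪ t ∧ ∀ x, X x a ≠ 0 ↔ x = b := by
  induction s using Finset.induction_on with
  | empty =>
    intro t ht _
    obtain rfl : t = ∅ := by simpa using ht.symm
    refine ⟨1, by simp [barTranspose_one], fun _ _ _ _ _ _ _ => Commute.one_right _,
      fun a _ _ => ⟨a, by simp, fun x => ?_⟩⟩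
    by_cases h : x = a <;> simp [h, Matrix.one_apply]
  | insert d s hds ih =>
    intro t ht hst
    rw [Finset.card_insert_of_notMem hds] at ht
    obtain ⟨c, hc⟩ : t.Nonempty := Finset.card_pos.1 (by omega)
    rw [Finset.disjoint_insert_left] at hst
    have hcs : c ∉ s := fun h => Finset.disjoint_left.1 hst.2 h hc
    have hcd : c ≠ d := fun h => hst.1 (h ▸ hc)
    obtain ⟨X, hX, hcomm, hmap⟩ := ih (t.erase c) (by rw [Finset.card_erase_of_mem hc]; omega)
      (hst.2.mono_right (Finset.erase_subset _ _))
    have hdt : d ∉ t.erase c := fun h => hst.1 (Finset.mem_of_mem_erase h)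
    have hcX : Commute (O.transfer c d) X :=
      hcomm c d hcs (Finset.notMem_erase _ _) hds hdt hcd
    refine ⟨O.transfer c d * X, ?_, ?_, ?_⟩
    · rw [barTranspose_mul, hX, barTranspose_transfer hcd, Finset.card_insert_of_notMem hds,
        pow_succ, mul_neg, smul_mul_assoc, ← hcX.eq]
      simp
    · intro c' d' h1 h2 h3 h4 h5
      rw [Finset.mem_insert, not_or] at h1 h3
      have e1 : c' ≠ c := fun h => h2 (h ▸ hc)
      have e2 : d' ≠ c := fun h => h4 (h ▸ hc)
      exact (hO.transfer_commute h5 hcd e1 h3.1 h1.1 e2).mul_right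
        (hcomm c' d' h1.2 (fun h => h2 (Finset.mem_of_mem_erase h)) h3.2
          (fun h => h4 (Finset.mem_of_mem_erase h)) h5)
    · intro a hs hdisj
      rw [Finset.insert_subset_iff] at hs
      obtain ⟨b, hb, hXb⟩ := hmap a hs.2 (hdisj.mono_left (Finset.erase_subset _ _))
      have hca : c ∉ O.cols a := Finset.disjoint_left.1 hdisj hc
      obtain ⟨b', hb', hEb⟩ := hO.exists_transfer_apply_ne_zero_iff (c := c) (d := d) (a := b)
        (by rw [hb]; simp [hs.1, hds]) (by rw [hb]; simp [hca])
      refine ⟨b', ?_, fun x => ?_⟩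
      · rw [hb', hb]
        ext x
        simp only [Finset.mem_insert, Finset.mem_erase, Finset.mem_union, Finset.mem_sdiff]
        by_cases hxc : x = c
        · subst hxc; simp [hc]
        · by_cases hxd : x = d
          · subst hxd; simp [hxc, hst.1]
          · simp [hxc, hxd]
      · rw [Matrix.mul_apply, Finset.sum_eq_single b, ← hEb]
        · have := (hXb b).2 rfl
          exact ⟨fun h => left_ne_zero_of_mul h, fun h => mul_ne_zero h this⟩
        · intro y _ hy
          have : X y a = 0 := by
            by_contra h0
            exact hy ((hXb y).1 h0)
          rw [this, mul_zero]
        · simp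

theorem exists_cols_eq {a : Fin k × Bool} {t : Finset (Fin n)} (ht : t.card = (O.cols a).card) :
    ∃ b, O.cols b = t := by
  obtain ⟨X, -, -, hX⟩ := hO.exists_exchange (O.cols a \ t) (t \ O.cols a)
    (by rw [Finset.card_sdiff_comm ht.symm]) disjoint_sdiff_sdiff
  obtain ⟨b, hb, -⟩ := hX a Finset.sdiff_subset Finset.sdiff_disjoint
  refine ⟨b, hb.trans ?_⟩
  ext x
  simp only [Finset.mem_union, Finset.mem_sdiff]
  tauto

/-- A literal that lies in an odd number of columns, half of them all, shares its columns with
another literal. -/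
theorem exists_ne_cols_eq {a : Fin k × Bool} (hodd : Odd (O.cols a).card)
    (hcard : (O.cols (bar a)).card = (O.cols a).card) :
    ∃ b, b ≠ a ∧ O.cols b = O.cols a := by
  rw [← hcard] at hodd
  obtain ⟨X, hX, -, hmap⟩ := hO.exists_exchange (O.cols (bar a)) (O.cols a) hcard
    (by rw [cols_bar]; exact disjoint_compl_left)
  obtain ⟨b, hb, hXb⟩ := hmap (bar a) subset_rfl
    (by rw [cols_bar]; exact disjoint_compl_right)
  refine ⟨b, ?_, by simpa using hb⟩
  rintro rfl
  have h1 := (hXb b).2 rfl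
  -- `barTranspose` fixes the position `(b, bar b)`, so this entry equals its own negative.
  have h2 := congrFun (congrFun hX b) (bar b)
  rw [hodd.neg_one_pow] at h2
  simp only [barTranspose, Matrix.submatrix_apply, Matrix.transpose_apply, bar_bar,
    Matrix.smul_apply, neg_smul, one_smul] at h2
  omega

end IsFull

end ComplexOrthogonalDesign

/-! ### Counting literals over the `m`-sets of columns -/

open ComplexOrthogonalDesign CODEntry in
theorem ComplexOrthogonalDesign.two_mul_choose_le {p m k : ℕ} (hm : Odd m)
    (O : ComplexOrthogonalDesign p (2 * m) k) (h : (m + 1) * p = 2 * m * k) (hk : 0 < k) :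
    2 * (2 * m).choose (m - 1) ≤ p := by
  have hO : O.IsFull := fun l r a => supp_eq_of_maximal_rate h
  have hcard := card_cols_of_maximal_rate (O := O) h
  have hfib : ∀ t ∈ Finset.powersetCard m (Finset.univ : Finset (Fin (2 * m))),
      2 ≤ (Finset.univ.filter fun a => O.cols a = t).card := by
    intro t ht
    obtain ⟨a, rfl⟩ := hO.exists_cols_eq (a := (⟨0, hk⟩, true)) (t := t)
      (by rw [hcard, (Finset.mem_powersetCard.1 ht).2])
    obtain ⟨b, hba, hb⟩ := hO.exists_ne_cols_eq (a := a) (by rw [hcard]; exact hm)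
      (by rw [hcard, hcard])
    exact Finset.one_lt_card.2 ⟨a, by simp, b, by simp [hb], hba.symm⟩
  have h1 := Finset.card_eq_sum_card_fiberwise (s := Finset.univ) (f := O.cols)
    (t := Finset.powersetCard m Finset.univ)
    (fun a _ => by simp [Finset.mem_powersetCard, hcard])
  have h2 := Finset.card_nsmul_le_sum _ _ _ hfib
  rw [← h1] at h2
  simp only [Finset.card_powersetCard, Finset.card_univ, Fintype.card_fin, Fintype.card_prod,
    Fintype.card_bool, smul_eq_mul] at h2
  obtain ⟨q, rfl⟩ : ∃ q, m = q + 1 := ⟨m - 1, by have := hm.pos; omega⟩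
  have h3 := Nat.choose_succ_right_eq (2 * (q + 1)) q
  rw [Nat.add_sub_cancel]
  have h4 : 2 * (q + 1) - q = q + 2 := by omega
  rw [h4] at h3
  nlinarith

theorem mainTheorem1 (m : ℕ) (hm : Odd m) :
    IsEmpty (ComplexOrthogonalDesign
      (Nat.choose (2 * m) (m - 1)) (2 * m) (Nat.choose (2 * m - 1) (m - 1))) ∧
    ∀ (p k : ℕ) (O : ComplexOrthogonalDesign p (2 * m) k),
      O.rate = ((m : ℚ) + 1) / (2 * (m : ℚ)) →
        2 * Nat.choose (2 * m) (m - 1) ≤ O.delay := by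
  have hpos := hm.pos
  constructor
  · refine ⟨fun O => ?_⟩
    -- These parameters have maximal rate, so the delay bound contradicts them.
    have h1 : (m + 1) * (2 * m).choose (m - 1) = 2 * m * (2 * m - 1).choose (m - 1) := by
      obtain ⟨q, rfl⟩ : ∃ q, m = q + 1 := ⟨m - 1, by omega⟩
      have h2 := Nat.add_one_mul_choose_eq (2 * q + 1) q
      have h3 := Nat.choose_succ_right_eq (2 * (q + 1)) q
      rw [show 2 * (q + 1) - q = q + 2 by omega] at h3
      rw [Nat.add_sub_cancel, show 2 * (q + 1) - 1 = 2 * q + 1 by omega]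
      rw [show 2 * q + 1 + 1 = 2 * (q + 1) by omega] at h2
      linarith
    have h2 := O.two_mul_choose_le hm h1 (Nat.choose_pos (by omega))
    have h3 : 0 < (2 * m).choose (m - 1) := Nat.choose_pos (by omega)
    omega
  · intro p k O hrate
    have hm0 : (0 : ℚ) < m := by exact_mod_cast hpos
    rw [ComplexOrthogonalDesign.rate] at hrate
    have hrhs : (0 : ℚ) < ((m : ℚ) + 1) / (2 * (m : ℚ)) := by positivity
    -- For `p = 0` the rate is `k / 0 = 0` by convention, which is not the positive maximal rate.
    have hp : (p : ℚ) ≠ 0 := by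
      intro h; rw [h, div_zero] at hrate; exact hrhs.ne hrate
    have hk : k ≠ 0 := by
      rintro rfl
      rw [Nat.cast_zero, zero_div] at hrate; exact hrhs.ne hrate
    rw [div_eq_div_iff hp (by positivity)] at hrate
    refine O.two_mul_choose_le hm ?_ (Nat.pos_of_ne_zero hk)
    have : ((m : ℚ) + 1) * p = 2 * m * k := by linarith
    exact_mod_cast this
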